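/- A scoring rule assigns a penalty $\ell(p,x)\in\mathbb R$ to a prediction $p\in[0,1]$ and an outcome $x\in\{0,1\}$. It is proper if for all $q,p\in[0,1]$, $$(1-q)\,\ell(q,0)+q\,\ell(q,1)\le(1-q)\,\ell(p,0)+q\,\ell(p,1).$$ Let $\mathcal L$ be the set of all proper scoring rules $\ell:[0,1]\times\{0,1\}\to[-1,1]$. For $v\in[0,1]$ let $\ell_v\in\mathcal L$ be the V-shaped scoring rule $\ell_v(p,0)=v\,\mathrm{sgn}(p-v)$, $\ell_v(p,1)=(1-v)\,\mathrm{sgn}(v-p)$ with $\mathrm{sgn}(0)=0$ (so $(1-p)\ell_v(p,0)+p\,\ell_v(p,1)=-|p-v|$). For outcomes $\mathbf x=(x_1,\dots,x_T)\in\{0,1\}^T$ and predictions $\mathbf p=(p_1,\dots,p_T)\in[0,1]^T$ put $\beta=\frac1T\sum_{t=1}^T x_t$ and $$\mathrm{Reg}_\ell(\mathbf p,\mathbf x)=\sum_{t=1}^T\ell(p_t,x_t)-\sum_{t=1}^T\ell(\beta,x_t),$$ $$\mathrm{VCal}(\mathbf p,\mathbf x)=\sup_{v\in[0,1]}\mathrm{Reg}_{\ell_v}(\mathbf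 p,\mathbf x),\qquad \mathrm{UCal}(\mathbf p,\mathbf x)=\sup_{\ell\in\mathcal L}\mathrm{Reg}_\ell(\mathbf p,\mathbf x).$$ The algorithm ForecastHedge with horizon $T$ is the following. Let $S(z)=e^z/(e^z+e^{-z})$ and $\eta=1/\sqrt T$. It predicts $p_1=1/2$. For $t=2,\dots,T$, with $\hat x_{t-1}=\frac1{t-1}\sum_{s=1}^{t-1}x_s$ the average of the outcomes observed so far, it samples, with fresh independent randomness, a prediction $p_t\in[0,1]$ such that $$\Pr[p_t\le v]=S\big(\eta\,(t-1)\,(v-\hat x_{t-1})\big)\qquad\text{for all }v\in[0,1).$$ **Theorem.** There is an absolute constant $C$ such that for every $T\ge1$ and every outcome sequence $\mathbf x\in\{0,1\}^T$, the predictions $\mathbf p$ of ForecastHedge on $\mathbf x$ satisfy $$\mathbb E\big[\mathrm{VCal}(\mathbf p,\mathbf x)\big]\le C\sqrt T\qquad\text{and}\qquad\mathbb E\big[\mathrm{UCal}(\mathbf p,\mathbf x)\big]\le C\sqrt T,$$ where both random variables are integrable. -/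

import Mathlib

open MeasureTheory Set Filter Topology

noncomputable section

namespace UCalibration

/-! ### Scoring rules -/

/-- A scoring rule: `ℓ p x` is the penalty for predicting probability `p ∈ [0,1]` when the binary
outcome is `x ∈ {0,1}`. -/
abbrev ScoringRule : Type := unitInterval → Fin 2 → ℝ

/-- The expected penalty `ℓ(p; q) = (1 - q) ℓ(p,0) + q ℓ(p,1)` of predicting `p` for an outcome
with law `Ber(q)`. -/
def expectedScore (ℓ : ScoringRule) (p q : unitInterval) : ℝ :=
  (1 - (q : ℝ)) * ℓ p 0 + (q : ℝ) * ℓ p 1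

/-- Proper: under `Ber(q)`, reporting `q` minimises the expected penalty. -/
def IsProper (ℓ : ScoringRule) : Prop :=
  ∀ q p : unitInterval, expectedScore ℓ q q ≤ expectedScore ℓ p q

/-- The set of all proper scoring rules with values in `[-1,1]`. -/
def boundedProperRules : Set ScoringRule :=
  {ℓ | IsProper ℓ ∧ ∀ p x, ℓ p x ∈ Icc (-1 : ℝ) 1}

/-- The V-shaped scoring rule centered at `v`: `ℓ_v(p,0) = v * sgn(p - v)` and
`ℓ_v(p,1) = (1 - v) * sgn(v - p)`, with `sgn 0 = 0`. -/
def vShaped (v : unitInterval) : ScoringRule := fun p x =>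
  if x = 0 then (v : ℝ) * Real.sign ((p : ℝ) - v) else (1 - (v : ℝ)) * Real.sign ((v : ℝ) - p)

/-- The univariate form of the V-shaped rule is `p ↦ -|p - v|`. -/
theorem vShaped_univariate (v p : unitInterval) :
    expectedScore (vShaped v) p p = -|(p : ℝ) - v| := by
  simp only [expectedScore, vShaped, if_true, one_ne_zero, if_false]
  rcases lt_trichotomy (p : ℝ) v with h | h | h
  · rw [Real.sign_of_neg (by linarith), Real.sign_of_pos (by linarith), abs_of_neg (by linarith)]
    ring
  · simp [h]
  · rw [Real.sign_of_pos (by linarith), Real.sign_of_neg (by linarith), abs_of_pos (by linarith)]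
    ring

/-- V-shaped rules are bounded proper scoring rules. -/
theorem vShaped_mem (v : unitInterval) : vShaped v ∈ boundedProperRules := by
  have hv0 := v.2.1
  have hv1 := v.2.2
  refine ⟨fun q p => ?_, fun p x => ?_⟩
  · rw [vShaped_univariate]
    have h1 := neg_abs_le ((q : ℝ) - v)
    have h2 := le_abs_self ((q : ℝ) - v)
    have h3 := abs_nonneg ((q : ℝ) - v)
    simp only [expectedScore, vShaped, if_true, one_ne_zero, if_false]
    rcases lt_trichotomy (p : ℝ) v with h | h | h
    · rw [Real.sign_of_neg (by linarith), Real.sign_of_pos (by linarith)]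
      nlinarith
    · simp [h]
    · rw [Real.sign_of_pos (by linarith), Real.sign_of_neg (by linarith)]
      nlinarith
  · simp only [vShaped, mem_Icc]
    split_ifs
    · rcases Real.sign_apply_eq ((p : ℝ) - v) with h | h | h <;> rw [h] <;>
        constructor <;> linarith
    · rcases Real.sign_apply_eq ((v : ℝ) - p) with h | h | h <;> rw [h] <;>
        constructor <;> linarith

/-! ### Regret against the base rate, V-calibration and U-calibration

Round `t` of `1, …, T` is represented by the index `t - 1 : Fin T`. -/

/-- The base rate `β = (1/T) ∑ x_t`. -/
def baseRate {T : ℕ} (x : Fin T → Fin 2) : unitInterval :=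
  ⟨(∑ t, ((x t : ℕ) : ℝ)) / T, by
    refine ⟨by positivity, div_le_one_of_le₀ ?_ (Nat.cast_nonneg T)⟩
    calc (∑ t, ((x t : ℕ) : ℝ)) ≤ ∑ _t : Fin T, (1 : ℝ) := by
          refine Finset.sum_le_sum fun t _ => ?_
          exact_mod_cast Nat.lt_succ_iff.mp (x t).2
      _ = T := by simp⟩

/-- `Reg_ℓ(p, x) = ∑ ℓ(p_t, x_t) - ∑ ℓ(β, x_t)`. -/
def regret (ℓ : ScoringRule) {T : ℕ} (p : Fin T → unitInterval) (x : Fin T → Fin 2) : ℝ :=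
  ∑ t, ℓ (p t) (x t) - ∑ t, ℓ (baseRate x) (x t)

/-- V-calibration error: the supremum of the regrets for V-shaped scoring rules. -/
def VCal {T : ℕ} (p : Fin T → unitInterval) (x : Fin T → Fin 2) : ℝ :=
  ⨆ v : unitInterval, regret (vShaped v) p x

/-- U-calibration error: the supremum of the regrets for bounded proper scoring rules. -/
def UCal {T : ℕ} (p : Fin T → unitInterval) (x : Fin T → Fin 2) : ℝ :=
  ⨆ ℓ : boundedProperRules, regret (ℓ : ScoringRule) p x

/-- The supremum defining `UCal` is over a bounded set of reals. -/
theorem bddAbove_regret {T : ℕ} (p : Fin T → unitInterval) (x : Fin T → Fin 2) :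
    BddAbove (range fun ℓ : boundedProperRules => regret (ℓ : ScoringRule) p x) := by
  refine ⟨2 * T, ?_⟩
  rintro _ ⟨ℓ, rfl⟩
  simp only [regret, ← Finset.sum_sub_distrib]
  calc _ ≤ ∑ _t : Fin T, (2 : ℝ) := Finset.sum_le_sum fun t _ => by
        have h1 := (ℓ.2.2 (p t) (x t)).2
        have h2 := (ℓ.2.2 (baseRate x) (x t)).1
        linarith
    _ = 2 * T := by simp [mul_comm]

/-- The supremum defining `VCal` is over a bounded set of reals. -/
theorem bddAbove_regret_vShaped {T : ℕ} (p : Fin T → unitInterval) (x : Fin T → Fin 2) :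
    BddAbove (range fun v : unitInterval => regret (vShaped v) p x) := by
  refine (bddAbove_regret p x).mono ?_
  rintro _ ⟨v, rfl⟩
  exact ⟨⟨vShaped v, vShaped_mem v⟩, rfl⟩

/-! ### The ForecastHedge algorithm -/

/-- `S(z) = e^z / (e^z + e^{-z})`. -/
def logisticS (z : ℝ) : ℝ := Real.exp z / (Real.exp z + Real.exp (-z))

theorem logisticS_mem (z : ℝ) : logisticS z ∈ Icc (0 : ℝ) 1 := by
  have h1 := Real.exp_pos z
  have h2 := Real.exp_pos (-z)
  exact ⟨by unfold logisticS; positivity,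
    (div_le_one (by linarith)).2 (by linarith)⟩

theorem logisticS_monotone : Monotone logisticS := by
  intro a b hab
  have h1 := Real.exp_pos a
  have h2 := Real.exp_pos (-a)
  have h3 := Real.exp_pos b
  have h4 := Real.exp_pos (-b)
  have h5 := Real.exp_le_exp.2 hab
  have h6 := Real.exp_le_exp.2 (neg_le_neg hab)
  unfold logisticS
  rw [div_le_div_iff₀ (by linarith) (by linarith)]
  nlinarith [mul_le_mul h5 h6 h4.le h3.le]

theorem logisticS_continuous : Continuous logisticS := by
  unfold logisticS
  refine Continuous.div (by fun_prop) (by fun_prop) fun z => ?_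
  have h1 := Real.exp_pos z
  have h2 := Real.exp_pos (-z)
  linarith

/-- The distribution function of a prediction in `[0,1]` with `Pr[p ≤ v] = S(c (v - m))` for all
`v ∈ [0,1)`. -/
def forecastCDF (c : NNReal) (m : ℝ) : StieltjesFunction ℝ where
  toFun v := if v < 0 then 0 else if v < 1 then logisticS (c * (v - m)) else 1
  mono' := by
    intro a b hab
    have ha := logisticS_mem (c * (a - m))
    have hb := logisticS_mem (c * (b - m))
    have hm : logisticS (c * (a - m)) ≤ logisticS (c * (b - m)) :=
      logisticS_monotone (mul_le_mul_of_nonneg_left (by linarith) c.2)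
    dsimp only
    split_ifs <;> first | exact le_rfl | exact hm | exact hb.1 | exact ha.2 | linarith
  right_continuous' := by
    intro a
    rcases lt_or_ge a 0 with h0 | h0
    · refine (continuousAt_const (y := (0 : ℝ))).continuousWithinAt.congr_of_eventuallyEq
        (mem_nhdsWithin_of_mem_nhds ?_) (if_pos h0)
      filter_upwards [Iio_mem_nhds h0] with v hv using if_pos hv
    rcases lt_or_ge a 1 with h1 | h1
    · have hc : Continuous fun v : ℝ => logisticS (c * (v - m)) :=
        logisticS_continuous.comp (by fun_prop)
      refine (hc.continuousAt (x := a)).continuousWithinAt.congr_of_eventuallyEq ?_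
        (by rw [if_neg h0.not_gt, if_pos h1])
      filter_upwards [self_mem_nhdsWithin, mem_nhdsWithin_of_mem_nhds (Iio_mem_nhds h1)]
        with v hv hv1
      rw [if_neg (not_lt.2 (h0.trans hv)), if_pos (mem_Iio.1 hv1)]
    · refine (continuousAt_const (y := (1 : ℝ))).continuousWithinAt.congr_of_eventuallyEq ?_
        (by rw [if_neg h0.not_gt, if_neg h1.not_gt])
      filter_upwards [self_mem_nhdsWithin] with v hv
      rw [if_neg (not_lt.2 (h0.trans hv)), if_neg (not_lt.2 (h1.trans hv))]

/-- The law on `[0,1]` with distribution function `forecastCDF c m`. -/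
def forecastLaw (c : NNReal) (m : ℝ) : Measure unitInterval :=
  (forecastCDF c m).measure.comap Subtype.val

theorem forecastLaw_Iic_aux (c : NNReal) (m : ℝ) (v : unitInterval) :
    forecastLaw c m (Iic v) = ENNReal.ofReal (forecastCDF c m v) := by
  have hl : Function.leftLim (forecastCDF c m) 0 = 0 := by
    refine leftLim_eq_of_tendsto ?_
    refine tendsto_const_nhds.congr' ?_
    filter_upwards [self_mem_nhdsWithin] with w hw
    exact (if_pos hw).symm
  have him : (Subtype.val '' Iic v : Set ℝ) = Icc 0 (v : ℝ) := by
    ext w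
    constructor
    · rintro ⟨u, hu, rfl⟩
      exact ⟨u.2.1, hu⟩
    · rintro ⟨h0, h1⟩
      exact ⟨⟨w, h0, h1.trans v.2.2⟩, h1, rfl⟩
  rw [forecastLaw, comap_subtype_coe_apply measurableSet_Icc, him,
    StieltjesFunction.measure_Icc, hl, sub_zero]

/-- The defining property `Pr[p ≤ v] = S(c (v - m))` for `v ∈ [0,1)`. -/
theorem forecastLaw_Iic (c : NNReal) (m : ℝ) (v : unitInterval) (hv : (v : ℝ) < 1) :
    forecastLaw c m (Iic v) = ENNReal.ofReal (logisticS (c * ((v : ℝ) - m))) := by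
  rw [forecastLaw_Iic_aux]
  congr 1
  exact (if_neg (not_lt.2 v.2.1)).trans (if_pos hv)

instance (c : NNReal) (m : ℝ) : IsProbabilityMeasure (forecastLaw c m) := by
  refine ⟨?_⟩
  have h : (univ : Set unitInterval) = Iic 1 := by
    ext w
    simp [unitInterval.le_one']
  rw [h, forecastLaw_Iic_aux]
  have : forecastCDF c m ((1 : unitInterval) : ℝ) = 1 := by
    change (if (1 : ℝ) < 0 then _ else if (1 : ℝ) < 1 then _ else _) = _
    norm_num
  rw [this, ENNReal.ofReal_one]

/-- The average of the outcomes observed before the round with index `t`; there are `t` of them. -/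
def pastMean {T : ℕ} (x : Fin T → Fin 2) (t : Fin T) : ℝ :=
  (∑ s ∈ Finset.univ.filter (fun s : Fin T => s < t), ((x s : ℕ) : ℝ)) / (t : ℕ)

/-- The law of the prediction in the round with index `t`: the first prediction is `1/2`, and after
`t ≥ 1` observed outcomes `Pr[p ≤ v] = S(η t (v - mean of these outcomes))`, `η = 1/√T`. -/
def hedgeRoundLaw {T : ℕ} (x : Fin T → Fin 2) (t : Fin T) : Measure unitInterval :=
  if (t : ℕ) = 0 then Measure.dirac ⟨1 / 2, by norm_num, by norm_num⟩
  else forecastLaw (1 / NNReal.sqrt T * (t : ℕ)) (pastMean x t)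

instance {T : ℕ} (x : Fin T → Fin 2) (t : Fin T) : IsProbabilityMeasure (hedgeRoundLaw x t) := by
  unfold hedgeRoundLaw
  split_ifs <;> infer_instance

/-- The joint law of the predictions `p_1, …, p_T` of ForecastHedge on the outcomes `x`. Every round
samples with fresh randomness from a law that depends on past outcomes only, not on past
predictions, so the predictions are independent. -/
def forecastHedge {T : ℕ} (x : Fin T → Fin 2) : Measure (Fin T → unitInterval) :=
  Measure.pi (hedgeRoundLaw x)

end UCalibration

end

/-!
Write `A(v) = ∑ (v - x_t) (1[v < p_t] - 1[v < β])` (`cutRegret`). Three facts give the theorem.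

*Every regret is controlled by cut regrets.* A proper rule `ℓ` assigns to each report `m` an affine
function of the outcome, with slope `ℓ(m,1) - ℓ(m,0)` decreasing in `m`. For consecutive points
`m < n` of `{0, 1, β, p_1, …, p_T}` these affine functions cross at some `y ∈ [m, n]`, so that moving
every report above `m` from `m` to `n` changes the regret by the drop of the slope times an affine
extension of `A` from `(m, n)` to `y`. Telescoping bounds the regret of `ℓ` by the total drop of the
slope, at most `4` for rules with values in `[-1,1]`, times any nonnegative bound on `A` over a dense
set of thresholds (`regret_le_of_cutRegret_le`). In particular a countable set of thresholds
suffices, and ties between predictions and thresholds play no role.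

*The expectation of `A(v)` is at most `2√T` for every `v`.* For fixed `v` the algorithm plays
exponential weights with two actions and gains `v - x_t`, and `A(v)` is its regret; the potential
`log cosh` gives the bound (`hedge_lower_bound`, `expected_cutRegret_le`).

*The deviation of `A(v)` from its expectation is `O(√T)` in expectation, uniformly in `v`.* It is a
combination of two weighted empirical processes indexed by thresholds. Symmetrization with a ghost
sample replaces them by Rademacher walks whose steps are ordered by the predictions, and the maximum
of such a walk is bounded by Doob's `L²` inequality, so no logarithmic factor appears
(`rademacher_maximal`, `lintegral_iSup_empirical_le`).

Measurability of the suprema over uncountably many rules holds because both are lower semicontinuous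
in the predictions (`lowerSemicontinuous_UCal`, `lowerSemicontinuous_VCal`).
-/

noncomputable section

namespace UCalibration

/-! ### Maximal inequality for Rademacher walks -/

/-- The real sign `±1` encoded by a Boolean. -/
def rsign (b : Bool) : ℝ := if b then 1 else -1

theorem rsign_not (b : Bool) : rsign (!b) = -rsign b := by
  cases b <;> simp [rsign]

theorem rsign_sq (b : Bool) : rsign b ^ 2 = 1 := by
  cases b <;> simp [rsign]

theorem rsign_sum_update {ι : Type*} [DecidableEq ι] (w : ι → ℝ) {a : ι} {s : Finset ι}
    (ha : a ∉ s) (ε : ι → Bool) (b : Bool) :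
    ∑ t ∈ s, rsign (Function.update ε a b t) * w t = ∑ t ∈ s, rsign (ε t) * w t := by
  refine Finset.sum_congr rfl fun t ht => ?_
  rw [Function.update_of_ne (ne_of_mem_of_not_mem ht ha)]

section Rademacher

variable {ι : Type*} [Fintype ι] [DecidableEq ι]

/-- A sign averages to zero against any function that does not depend on it. -/
theorem sum_mul_rsign_eq_zero (a : ι) (f : (ι → Bool) → ℝ)
    (hf : ∀ ε b, f (Function.update ε a b) = f ε) : ∑ ε, f ε * rsign (ε a) = 0 := by
  have hinv : Function.Involutive fun ε : ι → Bool => Function.update ε a (!ε a) := by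
    intro ε
    simp
  have h := Equiv.sum_comp hinv.toPerm fun ε => f ε * rsign (ε a)
  simp only [Function.Involutive.coe_toPerm, hf, Function.update_self, rsign_not, mul_neg,
    Finset.sum_neg_distrib] at h
  linarith

/-- The second moment of a Rademacher sum, as a sum over all sign vectors. -/
theorem sum_sq_rsign_sum (w : ι → ℝ) (s : Finset ι) :
    ∑ ε : ι → Bool, (∑ t ∈ s, rsign (ε t) * w t) ^ 2
      = Fintype.card (ι → Bool) * ∑ t ∈ s, w t ^ 2 := by
  induction s using Finset.induction_on with
  | empty => simp
  | insert a s ha ih =>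
    have h0 := sum_mul_rsign_eq_zero a (fun ε => ∑ t ∈ s, rsign (ε t) * w t)
      fun ε b => rsign_sum_update w ha ε b
    have h1 : ∀ ε : ι → Bool, (∑ t ∈ insert a s, rsign (ε t) * w t) ^ 2
        = (∑ t ∈ s, rsign (ε t) * w t) ^ 2
          + (2 * w a) * ((∑ t ∈ s, rsign (ε t) * w t) * rsign (ε a)) + w a ^ 2 := by
      intro ε
      rw [Finset.sum_insert ha]
      linear_combination (w a) ^ 2 * rsign_sq (ε a)
    rw [Finset.sum_congr rfl fun ε _ => h1 ε, Finset.sum_add_distrib, Finset.sum_add_distrib,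
      ← Finset.mul_sum, h0, ih, Finset.sum_insert ha, Finset.sum_const, Finset.card_univ,
      nsmul_eq_mul]
    ring

/-- For a Rademacher walk whose steps are taken in the order of the values `p`, the running maximum
`M` of the partial sums `∑_{p t ≤ v}` satisfies `𝔼 M² ≤ 2 𝔼 M S`, where `S` is the final sum. This is
the pathwise form of Doob's `L²` inequality; the induction inserts the step with the largest value of
`p` last, which makes sorting unnecessary and covers ties. -/
theorem exists_running_max {α : Type*} [LinearOrder α] (p : ι → α) (w : ι → ℝ) (s : Finset ι) :
    ∃ M : (ι → Bool) → ℝ, (∀ ε, 0 ≤ M ε) ∧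
      (∀ ε v, ∑ t ∈ s with p t ≤ v, rsign (ε t) * w t ≤ M ε) ∧
      (∀ a ∉ s, ∀ ε b, M (Function.update ε a b) = M ε) ∧
      ∑ ε, M ε ^ 2 ≤ 2 * ∑ ε, M ε * ∑ t ∈ s, rsign (ε t) * w t := by
  refine Finset.induction_on_max_value p s ⟨0, by simp⟩ fun a s ha hmax ih => ?_
  · obtain ⟨M, hM0, hM, hMu, hM2⟩ := ih
    refine ⟨fun ε => max (M ε) (∑ t ∈ insert a s, rsign (ε t) * w t),
      fun ε => le_max_of_le_left (hM0 ε), fun ε v => ?_, fun b hb ε c => ?_, ?_⟩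
    · by_cases hv : p a ≤ v
      · refine le_max_of_le_right (le_of_eq ?_)
        rw [Finset.filter_true_of_mem]
        intro x hx
        rcases Finset.mem_insert.1 hx with rfl | hx
        · exact hv
        · exact (hmax x hx).trans hv
      · rw [Finset.filter_insert, if_neg hv]
        exact le_max_of_le_left (hM ε v)
    · simp only
      rw [rsign_sum_update w hb, hMu b fun h => hb (Finset.mem_insert_of_mem h)]
    · have h0 := sum_mul_rsign_eq_zero a M fun ε b => hMu a ha ε b
      -- The maximum increases only when it equals the current partial sum.
      have key : ∀ ε : ι → Bool,
          (max (M ε) (∑ t ∈ insert a s, rsign (ε t) * w t)) ^ 2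
            - 2 * (max (M ε) (∑ t ∈ insert a s, rsign (ε t) * w t)
              * ∑ t ∈ insert a s, rsign (ε t) * w t)
          ≤ M ε ^ 2 - 2 * (M ε * ∑ t ∈ s, rsign (ε t) * w t)
            - (2 * w a) * (M ε * rsign (ε a)) := by
        intro ε
        rw [Finset.sum_insert ha]
        rcases le_total (M ε) (rsign (ε a) * w a + ∑ t ∈ s, rsign (ε t) * w t) with h | h
        · rw [max_eq_right h]
          nlinarith
        · rw [max_eq_left h]
          linarith
      have hs := Finset.sum_le_sum fun ε (_ : ε ∈ Finset.univ) => key ε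
      simp only [Finset.sum_sub_distrib, ← Finset.mul_sum, h0] at hs
      linarith

/-- Doob's `L²` maximal inequality for a Rademacher walk, followed by Cauchy–Schwarz. -/
theorem rademacher_maximal_one_sided {α : Type*} [LinearOrder α] (p : ι → α) (w : ι → ℝ) :
    ∃ M : (ι → Bool) → ℝ, (∀ ε, 0 ≤ M ε) ∧
      (∀ ε v, ∑ t with p t ≤ v, rsign (ε t) * w t ≤ M ε) ∧
      ∑ ε, M ε ≤ Fintype.card (ι → Bool) * (2 * √(∑ t, w t ^ 2)) := by
  obtain ⟨M, hM0, hM, -, hM2⟩ := exists_running_max p w Finset.univ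
  refine ⟨M, hM0, hM, ?_⟩
  have h1 := sum_sq_rsign_sum w Finset.univ
  set N : ℝ := (Fintype.card (ι → Bool) : ℝ)
  -- `2MS ≤ M² / 2 + 2S²` absorbs half of the left-hand side of `hM2`.
  have h2 : ∑ ε, M ε ^ 2 ≤ 4 * (N * ∑ t, w t ^ 2) := by
    have hp : ∀ ε : ι → Bool, 2 * (M ε * ∑ t, rsign (ε t) * w t)
        ≤ M ε ^ 2 / 2 + 2 * (∑ t, rsign (ε t) * w t) ^ 2 := fun ε => by
      nlinarith [sq_nonneg (M ε - 2 * ∑ t, rsign (ε t) * w t)]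
    have hs := Finset.sum_le_sum fun ε (_ : ε ∈ Finset.univ) => hp ε
    simp only [Finset.sum_add_distrib, ← Finset.mul_sum, ← Finset.sum_div, h1] at hs
    linarith
  have h3 := sq_sum_le_card_mul_sum_sq (s := (Finset.univ : Finset (ι → Bool))) (f := M)
  have hw : 0 ≤ ∑ t, w t ^ 2 := Finset.sum_nonneg fun t _ => sq_nonneg _
  have hN : 0 ≤ N := Nat.cast_nonneg _
  refine abs_le_of_sq_le_sq' ?_ (by positivity) |>.2
  rw [mul_pow, mul_pow, Real.sq_sqrt hw]
  rw [Finset.card_univ] at h3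
  change _ ≤ N * _ at h3
  nlinarith

/-- A maximal inequality for a Rademacher walk, whose steps are ordered by the values `p`. -/
theorem rademacher_maximal {α κ : Type*} [LinearOrder α] (c : κ → α) (p : ι → α) (w : ι → ℝ) :
    ∑ ε : ι → Bool, ⨆ k, ‖∑ t with p t ≤ c k, rsign (ε t) * w t‖ₑ
      ≤ Fintype.card (ι → Bool) * ENNReal.ofReal (4 * √(∑ t, w t ^ 2)) := by
  obtain ⟨M, hM0, hM, hMs⟩ := rademacher_maximal_one_sided p w
  obtain ⟨M', hM0', hM', hMs'⟩ := rademacher_maximal_one_sided p (-w)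
  have h1 : ∀ ε : ι → Bool, ⨆ k, ‖∑ t with p t ≤ c k, rsign (ε t) * w t‖ₑ
      ≤ ENNReal.ofReal (M ε + M' ε) := by
    refine fun ε => iSup_le fun k => ?_
    rw [Real.enorm_eq_ofReal_abs]
    refine ENNReal.ofReal_le_ofReal (abs_le'.2 ⟨?_, ?_⟩)
    · linarith [hM ε (c k), hM0' ε]
    · have := hM' ε (c k)
      simp only [Pi.neg_apply, mul_neg, Finset.sum_neg_distrib] at this
      linarith [hM0 ε]
  refine (Finset.sum_le_sum fun ε _ => h1 ε).trans ?_
  rw [← ENNReal.ofReal_sum_of_nonneg fun ε _ => add_nonneg (hM0 ε) (hM0' ε),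
    ← ENNReal.ofReal_natCast, ← ENNReal.ofReal_mul (Nat.cast_nonneg _)]
  refine ENNReal.ofReal_le_ofReal ?_
  rw [Finset.sum_add_distrib]
  simp only [Pi.neg_apply, neg_sq] at hMs'
  linarith

end Rademacher

/-! ### Symmetrization of weighted empirical processes -/

section Symmetrization

variable {ι : Type*} [Fintype ι]

variable {α κ : Type*} [LinearOrder α] [MeasurableSpace α]

/-- The weighted difference of the empirical distribution functions of the two halves of a paired
sample, maximised over the thresholds `c k`. -/
def pairedSup (c : κ → α) (w : ι → ℝ) (z : ι → α × α) : ENNReal :=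
  ⨆ k, ‖∑ t, w t * ((if (z t).1 ≤ c k then 1 else 0) - (if (z t).2 ≤ c k then 1 else 0))‖ₑ

theorem measurable_pairedSup [Countable κ] (hm : ∀ v : α, MeasurableSet (Iic v)) (c : κ → α)
    (w : ι → ℝ) : Measurable (pairedSup c w) := by
  refine Measurable.iSup fun k => Measurable.enorm ?_
  refine Finset.measurable_sum _ fun t _ => Measurable.const_mul (Measurable.sub ?_ ?_) _
  · exact Measurable.ite ((measurable_fst.comp (measurable_pi_apply t)) (hm (c k)))
      measurable_const measurable_const
  · exact Measurable.ite ((measurable_snd.comp (measurable_pi_apply t)) (hm (c k)))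
      measurable_const measurable_const

/-- Swapping the two members of independent identically distributed pairs flips the signs of the
summands, so that the paired process is dominated by Rademacher walks. -/
theorem lintegral_pairedSup_le [Countable κ] (hm : ∀ v : α, MeasurableSet (Iic v)) (c : κ → α)
    (w : ι → ℝ) (μ : ι → Measure α) [∀ t, IsProbabilityMeasure (μ t)] :
    ∫⁻ z, pairedSup c w z ∂(Measure.pi fun t => (μ t).prod (μ t))
      ≤ ENNReal.ofReal (8 * √(∑ t, w t ^ 2)) := by
  classical
  set ν := Measure.pi fun t => (μ t).prod (μ t)
  have hH := measurable_pairedSup hm c w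
  let F : (ι → Bool) → (ι → α × α) → ι → α × α := fun ε z t =>
    (if ε t then id else Prod.swap) (z t)
  have hF : ∀ ε, MeasurePreserving (F ε) ν ν := fun ε => by
    refine measurePreserving_pi _ _ (f := fun t => if ε t then id else Prod.swap) fun t => ?_
    split_ifs
    · exact MeasurePreserving.id _
    · exact Measure.measurePreserving_swap
  have hpt : ∀ z, ∑ ε, pairedSup c w (F ε z)
      ≤ Fintype.card (ι → Bool) * ENNReal.ofReal (8 * √(∑ t, w t ^ 2)) := fun z => by
    have hle : ∀ ε, pairedSup c w (F ε z)
        ≤ (⨆ k, ‖∑ t with (z t).1 ≤ c k, rsign (ε t) * w t‖ₑ)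
          + ⨆ k, ‖∑ t with (z t).2 ≤ c k, rsign (ε t) * w t‖ₑ := fun ε => by
      refine iSup_le fun k => ?_
      refine le_trans ?_ (add_le_add (le_iSup _ k) (le_iSup _ k))
      refine le_trans (le_of_eq ?_) (enorm_sub_le)
      congr 1
      rw [Finset.sum_filter, Finset.sum_filter, ← Finset.sum_sub_distrib]
      refine Finset.sum_congr rfl fun t _ => ?_
      cases h : ε t <;> simp only [F, h, rsign] <;> simp <;> split_ifs <;> simp
    refine (Finset.sum_le_sum fun ε _ => hle ε).trans ?_
    rw [Finset.sum_add_distrib]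
    refine (add_le_add (rademacher_maximal c (fun t => (z t).1) w)
      (rademacher_maximal c (fun t => (z t).2) w)).trans (le_of_eq ?_)
    rw [← mul_add, ← ENNReal.ofReal_add (by positivity) (by positivity)]
    ring_nf
  have hsum : (Fintype.card (ι → Bool) : ENNReal) * ∫⁻ z, pairedSup c w z ∂ν
      ≤ Fintype.card (ι → Bool) * ENNReal.ofReal (8 * √(∑ t, w t ^ 2)) := by
    calc _ = ∑ ε : ι → Bool, ∫⁻ z, pairedSup c w (F ε z) ∂ν := by
          rw [Finset.sum_congr rfl fun ε _ => (hF ε).lintegral_comp hH]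
          simp
      _ = ∫⁻ z, ∑ ε : ι → Bool, pairedSup c w (F ε z) ∂ν :=
          (lintegral_finsetSum _ fun ε _ => hH.comp (hF ε).measurable).symm
      _ ≤ ∫⁻ _, Fintype.card (ι → Bool) * ENNReal.ofReal (8 * √(∑ t, w t ^ 2)) ∂ν :=
          lintegral_mono hpt
      _ = _ := by simp
  exact (ENNReal.mul_le_mul_iff_right (by simp) (by simp)).1 hsum

/-- Uniform deviation of a weighted empirical distribution function: for independent, not
necessarily identically distributed variables, the expected supremum is `O(√(∑ w²))`, with no
logarithmic factor. -/
theorem lintegral_iSup_empirical_le [Countable κ] (hm : ∀ v : α, MeasurableSet (Iic v))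
    (c : κ → α) (w : ι → ℝ) (μ : ι → Measure α) [∀ t, IsProbabilityMeasure (μ t)] :
    ∫⁻ p, ⨆ k, ‖∑ t, w t * ((if p t ≤ c k then 1 else 0) - (μ t).real (Iic (c k)))‖ₑ
        ∂(Measure.pi μ) ≤ ENNReal.ofReal (8 * √(∑ t, w t ^ 2)) := by
  -- The distribution functions are averages over an independent copy `p'` of the sample.
  have hghost : ∀ p : ι → α,
      ⨆ k, ‖∑ t, w t * ((if p t ≤ c k then 1 else 0) - (μ t).real (Iic (c k)))‖ₑ
        ≤ ∫⁻ p', pairedSup c w (fun t => (p t, p' t)) ∂(Measure.pi μ) := fun p => by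
    refine iSup_le fun k => ?_
    have hmeas : ∀ t, Measurable fun p' : ι → α => if p' t ≤ c k then (1 : ℝ) else 0 := fun t =>
      Measurable.ite (p := fun p' : ι → α => p' t ∈ Iic (c k)) (measurable_pi_apply t (hm (c k)))
        measurable_const measurable_const
    have hint : ∀ t, Integrable (fun p' : ι → α => if p' t ≤ c k then (1 : ℝ) else 0)
        (Measure.pi μ) := fun t => by
      refine Integrable.of_bound (hmeas t).aestronglyMeasurable 1 (ae_of_all _ fun p' => ?_)
      split_ifs <;> simp
    have hval : ∀ t, ∫ p', (if p' t ≤ c k then (1 : ℝ) else 0) ∂(Measure.pi μ)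
        = (μ t).real (Iic (c k)) := fun t => by
      have h1 := (measurePreserving_eval μ t).measureReal_preimage (hm (c k)).nullMeasurableSet
      rw [← h1, ← integral_indicator_one ((measurable_pi_apply t) (hm (c k)))]
      refine integral_congr_ae (ae_of_all _ fun p' => ?_)
      by_cases h : p' t ≤ c k
      · exact (if_pos h).trans (Set.indicator_of_mem (s := (fun f : ι → α => f t) ⁻¹' Iic (c k))
          h 1).symm
      · exact (if_neg h).trans (Set.indicator_of_notMem
          (s := (fun f : ι → α => f t) ⁻¹' Iic (c k)) h 1).symm
    have hint2 : ∀ t, Integrable (fun p' : ι → α => w t * ((if p t ≤ c k then (1 : ℝ) else 0)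
        - (if p' t ≤ c k then 1 else 0))) (Measure.pi μ) := fun t =>
      ((integrable_const _).sub (hint t)).const_mul _
    have heq : ∑ t, w t * ((if p t ≤ c k then 1 else 0) - (μ t).real (Iic (c k)))
        = ∫ p', ∑ t, w t * ((if p t ≤ c k then 1 else 0) - (if p' t ≤ c k then 1 else 0))
          ∂(Measure.pi μ) := by
      rw [integral_finsetSum _ fun t _ => hint2 t]
      refine Finset.sum_congr rfl fun t _ => ?_
      rw [integral_const_mul, integral_sub (integrable_const _) (hint t), hval t]
      simp
    rw [heq]
    refine (enorm_integral_le_lintegral_enorm _).trans (lintegral_mono fun p' => ?_)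
    exact le_iSup (fun k => ‖∑ t, w t * ((if p t ≤ c k then (1 : ℝ) else 0)
      - (if p' t ≤ c k then 1 else 0))‖ₑ) k
  refine (lintegral_mono hghost).trans ?_
  have hH := measurable_pairedSup hm c w
  have hpres := (measurePreserving_arrowProdEquivProdArrow α α ι μ μ).symm
  have h2 := hpres.lintegral_comp hH
  rw [lintegral_prod (fun a => pairedSup c w
    ((MeasurableEquiv.arrowProdEquivProdArrow α α ι).symm a))
    (hH.comp hpres.measurable).aemeasurable] at h2
  refine le_trans (le_of_eq ?_) (lintegral_pairedSup_le hm c w μ)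
  exact h2

end Symmetrization

/-! ### Proper rules as combinations of threshold rules -/

/-- A set of thresholds that meets every nonempty open subinterval of `[0,1]`. -/
def MeetsIntervals (S : Set unitInterval) : Prop :=
  ∀ u w : unitInterval, u < w → ∃ v ∈ S, u < v ∧ v < w

/-- `∑ (v - x_t) (1[v < p_t] - 1[v < β])`: half the regret for the V-shaped rule centered at a
threshold `v` that is neither a prediction nor the base rate. -/
def cutRegret (v : unitInterval) {T : ℕ} (p : Fin T → unitInterval) (x : Fin T → Fin 2) : ℝ :=
  ∑ t, ((v : ℝ) - (x t : ℕ)) *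
    ((if v < p t then 1 else 0) - (if v < baseRate x then 1 else 0))

/-- On an interval `(u, w)` that contains no prediction and not the base rate, the cut regret is
affine in the threshold, so a bound at a dense set of thresholds extends to `[u, w]`. -/
theorem affine_cut_le {T : ℕ} {p : Fin T → unitInterval} {x : Fin T → Fin 2} {B : ℝ}
    {S : Set unitInterval} (hS : MeetsIntervals S) (hB : ∀ v ∈ S, cutRegret v p x ≤ B)
    {u w : unitInterval} (huw : u < w) (hp : ∀ t, u < p t → w ≤ p t)
    (hβ : u < baseRate x → w ≤ baseRate x) {y : ℝ} (hy : y ∈ Icc (u : ℝ) w) :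
    ∑ t, (y - (x t : ℕ)) * ((if u < p t then 1 else 0) - (if u < baseRate x then 1 else 0))
      ≤ B := by
  set h : ℝ → ℝ := fun y => ∑ t, (y - (x t : ℕ)) *
    ((if u < p t then 1 else 0) - (if u < baseRate x then 1 else 0))
  have hc : Continuous h := by fun_prop
  have hiff : ∀ q v : unitInterval, (u < q → w ≤ q) → u < v → v < w → (v < q ↔ u < q) :=
    fun q v hq h1 h2 => ⟨fun h => h1.trans h, fun h => h2.trans_le (hq h)⟩
  have hval : ∀ v ∈ S, u < v → v < w → h v ≤ B := fun v hv h1 h2 => by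
    refine le_trans (le_of_eq ?_) (hB v hv)
    refine Finset.sum_congr rfl fun t _ => ?_
    simp only [hiff (p t) v (hp t) h1 h2, hiff (baseRate x) v hβ h1 h2]
  have hcl : IsClosed {y | h y ≤ B} := isClosed_le hc continuous_const
  have huw' : (u : ℝ) < w := huw
  have hdense : Icc (u : ℝ) w ⊆ closure {y | h y ≤ B} := by
    rw [← closure_Ioo huw'.ne]
    refine closure_minimal (fun z hz => ?_) isClosed_closure
    rw [Metric.mem_closure_iff]
    intro ε hε
    obtain ⟨v, hv, h1, h2⟩ := hS ⟨z, u.2.1.trans hz.1.le, hz.2.le.trans w.2.2⟩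
      ⟨min w (z + ε), le_min w.2.1 (by linarith [u.2.1, hz.1]), (min_le_left _ _).trans w.2.2⟩
      (by
        change z < min (w : ℝ) (z + ε)
        exact lt_min hz.2 (by linarith))
    have h1' : z < (v : ℝ) := h1
    have h2' : (v : ℝ) < min (w : ℝ) (z + ε) := h2
    refine ⟨v, hval v hv ?_ ?_, ?_⟩
    · change (u : ℝ) < v
      exact hz.1.trans h1'
    · change (v : ℝ) < w
      exact h2'.trans_le (min_le_left _ _)
    · rw [Real.dist_eq, abs_lt]
      constructor <;> linarith [h2'.trans_le (min_le_right _ _)]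
  rw [hcl.closure_eq] at hdense
  exact hdense hy

/-- The slope in the outcome of the penalty of a fixed report. -/
def scoreSlope (ℓ : ScoringRule) (p : unitInterval) : ℝ := ℓ p 1 - ℓ p 0

theorem expectedScore_eq (ℓ : ScoringRule) (p q : unitInterval) :
    expectedScore ℓ p q = ℓ p 0 + scoreSlope ℓ p * q := by
  unfold expectedScore scoreSlope
  ring

theorem score_eq (ℓ : ScoringRule) (p : unitInterval) (i : Fin 2) :
    ℓ p i = ℓ p 0 + scoreSlope ℓ p * (i : ℕ) := by
  fin_cases i <;> simp [scoreSlope]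

/-- The penalties of two reports of a proper rule differ, up to the factor by which the slope
decreases, by the difference of a threshold between the reports and the outcome. -/
theorem IsProper.exists_crossing {ℓ : ScoringRule} (h : IsProper ℓ) {m n : unitInterval}
    (hmn : m < n) : scoreSlope ℓ n ≤ scoreSlope ℓ m ∧ ∃ y ∈ Icc (m : ℝ) n, ∀ i : Fin 2,
      ℓ n i - ℓ m i = (scoreSlope ℓ m - scoreSlope ℓ n) * (y - (i : ℕ)) := by
  have h1 := h m n
  have h2 := h n m
  simp only [expectedScore_eq] at h1 h2
  have hmn' : (m : ℝ) < n := hmn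
  have hg : scoreSlope ℓ n ≤ scoreSlope ℓ m := by nlinarith
  refine ⟨hg, ?_⟩
  rcases hg.eq_or_lt with he | hlt
  · refine ⟨m, ⟨le_rfl, hmn'.le⟩, fun i => ?_⟩
    rw [score_eq ℓ n, score_eq ℓ m, he]
    rw [he] at h1 h2
    linarith
  · have hd : 0 < scoreSlope ℓ m - scoreSlope ℓ n := sub_pos.2 hlt
    refine ⟨(ℓ n 0 - ℓ m 0) / (scoreSlope ℓ m - scoreSlope ℓ n), ⟨?_, ?_⟩, fun i => ?_⟩
    · rw [le_div_iff₀ hd]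
      linarith
    · rw [div_le_iff₀ hd]
      linarith
    · rw [score_eq ℓ n, score_eq ℓ m]
      field_simp
      ring

/-- The regret of a proper rule is a nonnegative combination, of total mass the drop of its slope
over `[0,1]`, of cut regrets between consecutive points of `{0, 1, β, p_1, …, p_T}`. -/
theorem regret_le_of_cutRegret_le {T : ℕ} {p : Fin T → unitInterval} {x : Fin T → Fin 2} {B : ℝ}
    {S : Set unitInterval} (hS : MeetsIntervals S) (hB : ∀ v ∈ S, cutRegret v p x ≤ B)
    {ℓ : ScoringRule} (hℓ : IsProper ℓ) :
    regret ℓ p x ≤ (scoreSlope ℓ 0 - scoreSlope ℓ 1) * B := by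
  classical
  set P : Finset unitInterval := insert 0 (insert 1 (insert (baseRate x) (Finset.univ.image p)))
  -- The regret after truncating predictions and base rate at `m`, for `m` running through `P`.
  have main : ∀ k : ℕ, ∀ m ∈ P, (P.filter (· < m)).card = k →
      regret (fun q => ℓ (min q m)) p x ≤ (scoreSlope ℓ 0 - scoreSlope ℓ m) * B := by
    intro k
    induction k using Nat.strong_induction_on with
    | _ k ih =>
      intro m hm hk
      rcases (P.filter (· < m)).eq_empty_or_nonempty with he | hne
      · have hm0 : m = 0 := by
          by_contra hm0
          have : (0 : unitInterval) ∈ P.filter (· < m) :=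
            Finset.mem_filter.2 ⟨by simp [P], unitInterval.pos_iff_ne_zero.2 hm0⟩
          simp [he] at this
        subst hm0
        simp [regret]
      · set n := (P.filter (· < m)).max' hne
        obtain ⟨hnP, hnm⟩ := Finset.mem_filter.1 ((P.filter (· < m)).max'_mem hne)
        change n ∈ P at hnP
        change n < m at hnm
        have hgap : ∀ q ∈ P, n < q → m ≤ q := fun q hq hnq => by
          by_contra! hqm
          exact (Finset.le_max' _ q (Finset.mem_filter.2 ⟨hq, hqm⟩)).not_gt hnq
        have hlt : (P.filter (· < n)).card < k := by
          rw [← hk]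
          refine Finset.card_lt_card (Finset.ssubset_iff_of_subset ?_ |>.2 ⟨n, ?_, ?_⟩)
          · exact Finset.monotone_filter_right _ fun q _ hq => hq.trans hnm
          · exact Finset.mem_filter.2 ⟨hnP, hnm⟩
          · simp
        have hind := ih _ hlt n hnP rfl
        obtain ⟨hg, y, hy, hcross⟩ := hℓ.exists_crossing hnm
        have hpP : ∀ t, p t ∈ P := fun t => by simp [P]
        have hβP : baseRate x ∈ P := by simp [P]
        have hcut := affine_cut_le hS hB hnm (fun t => hgap _ (hpP t)) (hgap _ hβP) hy
        have hstep : ∀ q ∈ P, ∀ i : Fin 2, ℓ (min q m) i - ℓ (min q n) i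
            = (scoreSlope ℓ n - scoreSlope ℓ m) * ((y - (i : ℕ)) * if n < q then 1 else 0) := by
          intro q hq i
          split_ifs with hnq
          · rw [min_eq_right (hgap q hq hnq), min_eq_right hnq.le, hcross]
            ring
          · rw [min_eq_left (not_lt.1 hnq), min_eq_left ((not_lt.1 hnq).trans hnm.le)]
            ring
        have hdiff : regret (fun q => ℓ (min q m)) p x - regret (fun q => ℓ (min q n)) p x
            = (scoreSlope ℓ n - scoreSlope ℓ m) * ∑ t, (y - (x t : ℕ)) *
              ((if n < p t then 1 else 0) - (if n < baseRate x then 1 else 0)) := by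
          simp only [regret, ← Finset.sum_sub_distrib, Finset.mul_sum]
          refine Finset.sum_congr rfl fun t _ => ?_
          linear_combination hstep _ (hpP t) (x t) - hstep _ hβP (x t)
        have := mul_le_mul_of_nonneg_left hcut (sub_nonneg.2 hg)
        linarith
  have h1 := main _ 1 (by simp [P]) rfl
  have : ∀ q : unitInterval, min q 1 = q := fun q => min_eq_left unitInterval.le_one'
  simpa only [this] using h1

theorem regret_le_four_mul {T : ℕ} {p : Fin T → unitInterval} {x : Fin T → Fin 2} {B : ℝ}
    {S : Set unitInterval} (hS : MeetsIntervals S) (hB : ∀ v ∈ S, cutRegret v p x ≤ B)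
    (hB0 : 0 ≤ B) {ℓ : ScoringRule} (hℓ : ℓ ∈ boundedProperRules) : regret ℓ p x ≤ 4 * B := by
  refine (regret_le_of_cutRegret_le hS hB hℓ.1).trans (mul_le_mul_of_nonneg_right ?_ hB0)
  unfold scoreSlope
  linarith [(hℓ.2 0 1).2, (hℓ.2 0 0).1, (hℓ.2 1 1).1, (hℓ.2 1 0).2]

theorem scoreSlope_vShaped (v p : unitInterval) :
    scoreSlope (vShaped v) p = Real.sign ((v : ℝ) - p) := by
  have : Real.sign ((p : ℝ) - v) = -Real.sign ((v : ℝ) - p) := by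
    rw [← Real.sign_neg, neg_sub]
  simp only [scoreSlope, vShaped, if_true, one_ne_zero, if_false, this]
  ring

theorem sum_outcomes {T : ℕ} (x : Fin T → Fin 2) :
    ∑ t, ((x t : ℕ) : ℝ) = T * (baseRate x : ℝ) := by
  rcases T.eq_zero_or_pos with rfl | hT
  · simp
  · have : (T : ℝ) ≠ 0 := by positivity
    simp only [baseRate]
    field_simp

theorem sum_score_baseRate (ℓ : ScoringRule) {T : ℕ} (x : Fin T → Fin 2) :
    ∑ t, ℓ (baseRate x) (x t) = T * expectedScore ℓ (baseRate x) (baseRate x) := by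
  rw [Finset.sum_congr rfl fun t _ => score_eq ℓ (baseRate x) (x t), Finset.sum_add_distrib,
    ← Finset.mul_sum, sum_outcomes, expectedScore_eq]
  simp
  ring

/-- No report has a smaller penalty than `x - 1` under `ℓ_1`, and the base rate attains this bound on
average. -/
theorem regret_vShaped_one_nonneg {T : ℕ} (p : Fin T → unitInterval) (x : Fin T → Fin 2) :
    0 ≤ regret (vShaped 1) p x := by
  have h1 : ∀ (q : unitInterval) (i : Fin 2), (i : ℕ) - 1 ≤ vShaped 1 q i := fun q i => by
    have := ((vShaped_mem 1).2 q 0).1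
    fin_cases i
    · simpa using this
    · simp [vShaped]
  have h2 : ∑ t, ((x t : ℕ) - 1 : ℝ) ≤ ∑ t, vShaped 1 (p t) (x t) :=
    Finset.sum_le_sum fun t _ => h1 _ _
  have h3 : -|(baseRate x : ℝ) - 1| = baseRate x - 1 := by
    rw [abs_of_nonpos (by linarith [(baseRate x).2.2])]
    ring
  rw [regret, sum_score_baseRate, vShaped_univariate, Set.Icc.coe_one, h3]
  simp only [Finset.sum_sub_distrib, sum_outcomes, Finset.sum_const, Finset.card_univ,
    Fintype.card_fin, nsmul_eq_mul] at h2
  linarith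

/-- A bound on the cut regrets is nonnegative, since the regret for `ℓ_1` is. -/
theorem nonneg_of_cutRegret_le {T : ℕ} {p : Fin T → unitInterval} {x : Fin T → Fin 2} {B : ℝ}
    {S : Set unitInterval} (hS : MeetsIntervals S) (hB : ∀ v ∈ S, cutRegret v p x ≤ B) :
    0 ≤ B := by
  have h := regret_le_of_cutRegret_le hS hB (vShaped_mem 1).1
  rw [scoreSlope_vShaped, scoreSlope_vShaped] at h
  have h0 := regret_vShaped_one_nonneg p x
  simp at h
  linarith

theorem regret_vShaped_le {T : ℕ} {p : Fin T → unitInterval} {x : Fin T → Fin 2} {B : ℝ}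
    {S : Set unitInterval} (hS : MeetsIntervals S) (hB : ∀ v ∈ S, cutRegret v p x ≤ B)
    (v : unitInterval) : regret (vShaped v) p x ≤ 2 * B := by
  refine (regret_le_of_cutRegret_le hS hB (vShaped_mem v).1).trans
    (mul_le_mul_of_nonneg_right ?_ (nonneg_of_cutRegret_le hS hB))
  rw [scoreSlope_vShaped, scoreSlope_vShaped]
  rcases Real.sign_apply_eq ((v : ℝ) - (0 : unitInterval)) with h | h | h <;>
  rcases Real.sign_apply_eq ((v : ℝ) - (1 : unitInterval)) with h' | h' | h' <;>
  rw [h, h'] <;> norm_num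

theorem vShaped_of_ne {v p : unitInterval} (h : p ≠ v) (i : Fin 2) :
    vShaped v p i = ((v : ℝ) - (i : ℕ)) * (2 * (if v < p then 1 else 0) - 1) := by
  rcases lt_or_gt_of_ne h with h | h
  · have h' : (p : ℝ) < v := h
    fin_cases i <;> simp [vShaped, h.not_gt, Real.sign_of_neg (sub_neg.2 h'),
      Real.sign_of_pos (sub_pos.2 h')]
  · have h' : (v : ℝ) < p := h
    fin_cases i <;> simp [vShaped, h, Real.sign_of_neg (sub_neg.2 h'),
      Real.sign_of_pos (sub_pos.2 h')] <;> ring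

theorem regret_vShaped_eq {T : ℕ} {p : Fin T → unitInterval} {x : Fin T → Fin 2}
    {v : unitInterval} (hp : ∀ t, p t ≠ v) (hβ : baseRate x ≠ v) :
    regret (vShaped v) p x = 2 * cutRegret v p x := by
  simp only [regret, cutRegret, ← Finset.sum_sub_distrib, Finset.mul_sum]
  refine Finset.sum_congr rfl fun t _ => ?_
  rw [vShaped_of_ne (hp t), vShaped_of_ne hβ]
  ring

/-! ### Lower semicontinuity of the calibration errors -/

/-- A finite menu of penalties, in which every report `q i` strictly prefers its own entry `a i` to
all different entries, is realised by a bounded proper rule: let every other report choose an entry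
with the smallest expected penalty. -/
theorem exists_boundedProperRule_of_menu {ι : Type*} [Finite ι] [Nonempty ι] (q : ι → unitInterval)
    (a : ι → Fin 2 → ℝ) (hb : ∀ i x, a i x ∈ Icc (-1 : ℝ) 1)
    (h : ∀ i j, a i = a j ∨
      (1 - (q i : ℝ)) * a i 0 + q i * a i 1 < (1 - (q i : ℝ)) * a j 0 + q i * a j 1) :
    ∃ ℓ ∈ boundedProperRules, ∀ i, ℓ (q i) = a i := by
  have hmin : ∀ u : unitInterval, ∃ i, ∀ j,
      (1 - (u : ℝ)) * a i 0 + u * a i 1 ≤ (1 - (u : ℝ)) * a j 0 + u * a j 1 := fun u =>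
    Finite.exists_min fun i => (1 - (u : ℝ)) * a i 0 + u * a i 1
  choose c hc using hmin
  refine ⟨fun u => a (c u), ⟨fun u v => hc u (c v), fun u x => hb _ x⟩, fun i => ?_⟩
  rcases h i (c (q i)) with h | h
  · exact h.symm
  · exact absurd (hc (q i) i) (not_le.2 h)

/-- The strictly proper quadratic score. -/
def brierRule : ScoringRule := fun p x => ((p : ℝ) - (x : ℕ)) ^ 2

theorem expectedScore_brierRule (p q : unitInterval) :
    expectedScore brierRule p q = expectedScore brierRule q q + ((p : ℝ) - q) ^ 2 := by
  simp [expectedScore, brierRule]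
  ring

theorem brierRule_mem (p : unitInterval) (x : Fin 2) : brierRule p x ∈ Icc (0 : ℝ) 1 := by
  have h0 := p.2.1
  have h1 := p.2.2
  refine ⟨sq_nonneg _, ?_⟩
  rw [brierRule, sq_le_one_iff_abs_le_one, abs_le]
  fin_cases x <;> constructor <;> norm_num <;> linarith

/-- A rule of regret above `a` at `p` can be made strictly proper by mixing in a small multiple of
the quadratic score; its values at the predictions and the base rate then remain the values of a
bounded proper rule when the predictions are perturbed. -/
theorem lowerSemicontinuous_UCal {T : ℕ} (x : Fin T → Fin 2) :
    LowerSemicontinuous fun p => UCal p x := by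
  intro p a ha
  have : Nonempty boundedProperRules := ⟨⟨vShaped 0, vShaped_mem 0⟩⟩
  obtain ⟨⟨ℓ, hℓ⟩, hreg⟩ := exists_lt_of_lt_ciSup ha
  change a < regret ℓ p x at hreg
  have hcont : Continuous fun ε : ℝ => (1 - ε) * regret ℓ p x + ε * regret brierRule p x := by
    fun_prop
  have hev : ∀ᶠ ε in 𝓝[>] (0 : ℝ), a < (1 - ε) * regret ℓ p x + ε * regret brierRule p x := by
    refine (hcont.tendsto 0).mono_left nhdsWithin_le_nhds |>.eventually (lt_mem_nhds ?_)
    simpa using hreg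
  obtain ⟨ε, hε, hε0, hε1⟩ := (hev.and (Ioo_mem_nhdsGT one_pos)).exists
  set ℓ' : ScoringRule := fun q i => (1 - ε) * ℓ q i + ε * brierRule q i
  have hreg' : a < regret ℓ' p x := by
    refine hε.trans_eq ?_
    simp only [regret, ℓ', Finset.sum_add_distrib, ← Finset.mul_sum]
    ring
  have hstrict : ∀ q r : unitInterval, q ≠ r → expectedScore ℓ' q q < expectedScore ℓ' r q := by
    intro q r hqr
    have h1 : ∀ r, expectedScore ℓ' r q
        = (1 - ε) * expectedScore ℓ r q + ε * expectedScore brierRule r q := fun r => by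
      simp only [expectedScore, ℓ']
      ring
    rw [h1, h1, expectedScore_brierRule r q]
    have h2 := mul_le_mul_of_nonneg_left (hℓ.1 q r) (sub_nonneg.2 hε1.le)
    have h3 : 0 < ((r : ℝ) - q) ^ 2 := by
      have : (r : ℝ) - q ≠ 0 := sub_ne_zero.2 fun h => hqr (Subtype.ext h.symm)
      positivity
    have := mul_pos hε0 h3
    linarith
  let Q : (Fin T → unitInterval) → Option (Fin T) → unitInterval := fun p' i =>
    i.elim (baseRate x) p'
  have hQ : ∀ i, Continuous fun p' => (Q p' i : ℝ) := fun i => by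
    cases i with
    | none => exact continuous_const
    | some t => exact continuous_subtype_val.comp (continuous_apply t)
  have hall : ∀ᶠ p' in 𝓝 p, ∀ i j, ℓ' (Q p i) = ℓ' (Q p j) ∨
      (1 - (Q p' i : ℝ)) * ℓ' (Q p i) 0 + Q p' i * ℓ' (Q p i) 1
        < (1 - (Q p' i : ℝ)) * ℓ' (Q p j) 0 + Q p' i * ℓ' (Q p j) 1 := by
    rw [eventually_all]
    intro i
    rw [eventually_all]
    intro j
    by_cases hij : Q p i = Q p j
    · exact Eventually.of_forall fun _ => Or.inl (by rw [hij])
    · have hc := hQ i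
      have h1 : Continuous fun p' : Fin T → unitInterval =>
          (1 - (Q p' i : ℝ)) * ℓ' (Q p i) 0 + Q p' i * ℓ' (Q p i) 1 := by fun_prop
      have h2 : Continuous fun p' : Fin T → unitInterval =>
          (1 - (Q p' i : ℝ)) * ℓ' (Q p j) 0 + Q p' i * ℓ' (Q p j) 1 := by fun_prop
      filter_upwards [(h1.tendsto p).eventually_lt (h2.tendsto p) (hstrict _ _ hij)] with p' hp'
      exact Or.inr hp'
  filter_upwards [hall] with p' hp'
  obtain ⟨ℓ'', hℓ'', hval⟩ := exists_boundedProperRule_of_menu (Q p') (fun i => ℓ' (Q p i))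
    (fun i y => by
      have h1 := hℓ.2 (Q p i) y
      have h2 := brierRule_mem (Q p i) y
      simp only [ℓ', mem_Icc] at h1 h2 ⊢
      constructor <;> nlinarith) hp'
  have heq : regret ℓ'' p' x = regret ℓ' p x := by
    have h1 : ℓ'' (baseRate x) = ℓ' (baseRate x) := hval none
    have h2 : ∀ t, ℓ'' (p' t) = ℓ' (p t) := fun t => hval (some t)
    simp only [regret, h1, h2]
  rw [← heq] at hreg'
  exact hreg'.trans_le (le_ciSup (bddAbove_regret p' x) ⟨ℓ'', hℓ''⟩)

theorem meetsIntervals_notMem_finset (P : Finset unitInterval) :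
    MeetsIntervals {v | v ∉ P} := by
  intro u w huw
  have hinf : (Ioo (u : ℝ) w).Infinite := Ioo_infinite huw
  obtain ⟨y, hy, hyP⟩ := hinf.exists_notMem_finset (P.image Subtype.val)
  refine ⟨⟨y, u.2.1.trans hy.1.le, hy.2.le.trans w.2.2⟩, fun h => hyP ?_, hy.1, hy.2⟩
  exact Finset.mem_image_of_mem Subtype.val h

/-- A regret above `a` for some V-shaped rule occurs at a center off the predictions and the base
rate, where the regret is locally constant in the predictions. -/
theorem lowerSemicontinuous_VCal {T : ℕ} (x : Fin T → Fin 2) :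
    LowerSemicontinuous fun p => VCal p x := by
  classical
  intro p a ha
  obtain ⟨v₀, hv₀⟩ := exists_lt_of_lt_ciSup ha
  have hS := meetsIntervals_notMem_finset (insert (baseRate x) (Finset.univ.image p))
  have hgen : ∃ v ∈ {v | v ∉ insert (baseRate x) (Finset.univ.image p)},
      a / 2 < cutRegret v p x := by
    by_contra! hcon
    have := regret_vShaped_le hS hcon v₀
    linarith
  obtain ⟨v, hv, hva⟩ := hgen
  simp only [Finset.mem_insert, Finset.mem_image, Finset.mem_univ, true_and, not_or, not_exists,
    mem_ofPred_eq] at hv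
  have hloc : ∀ᶠ p' in 𝓝 p, ∀ t, p' t ≠ v ∧ (v < p' t ↔ v < p t) := by
    rw [eventually_all]
    intro t
    have ht := (continuous_apply (A := fun _ : Fin T => unitInterval) t).tendsto p
    rcases lt_or_gt_of_ne (hv.2 t) with h | h
    · filter_upwards [ht.eventually (Iio_mem_nhds h)] with p' hp'
      exact ⟨ne_of_lt hp', iff_of_false (not_lt.2 (le_of_lt hp')) h.not_gt⟩
    · filter_upwards [ht.eventually (Ioi_mem_nhds h)] with p' hp'
      exact ⟨ne_of_gt hp', iff_of_true hp' h⟩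
  filter_upwards [hloc] with p' hp'
  have heq : cutRegret v p' x = cutRegret v p x := by
    simp only [cutRegret, (hp' _).2]
  have hr := regret_vShaped_eq (x := x) (fun t => (hp' t).1) (Ne.symm hv.1)
  rw [heq] at hr
  refine lt_of_lt_of_le ?_ (le_ciSup (bddAbove_regret_vShaped p' x) v)
  change a < regret (vShaped v) p' x
  linarith

/-! ### Comparison of the two errors -/

theorem regret_vShaped_le_UCal {T : ℕ} (v : unitInterval) (p : Fin T → unitInterval)
    (x : Fin T → Fin 2) : regret (vShaped v) p x ≤ UCal p x :=
  le_ciSup (bddAbove_regret p x) ⟨vShaped v, vShaped_mem v⟩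

theorem VCal_le_UCal {T : ℕ} (p : Fin T → unitInterval) (x : Fin T → Fin 2) :
    VCal p x ≤ UCal p x :=
  ciSup_le fun v => regret_vShaped_le_UCal v p x

theorem VCal_nonneg {T : ℕ} (p : Fin T → unitInterval) (x : Fin T → Fin 2) : 0 ≤ VCal p x :=
  (regret_vShaped_one_nonneg p x).trans (le_ciSup (bddAbove_regret_vShaped p x) 1)

/-! ### Exponential weights at a fixed threshold -/

/-- One step of the potential: `S(z) e^w + (1 - S(z)) e^{-w} = cosh (z + w) / cosh z`. -/
theorem log_cosh_add_le (z : ℝ) {w : ℝ} (hw : |w| ≤ 1) :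
    Real.log (Real.cosh (z + w))
      ≤ Real.log (Real.cosh z) + ((2 * logisticS z - 1) * w + w ^ 2) := by
  obtain ⟨hS0, hS1⟩ := logisticS_mem z
  have hc := Real.cosh_pos z
  have h1 := (abs_le.1 (Real.abs_exp_sub_one_sub_id_le hw)).2
  have h2 := (abs_le.1 (Real.abs_exp_sub_one_sub_id_le ((abs_neg w).le.trans hw))).2
  have heq : Real.cosh (z + w)
      = Real.cosh z * (logisticS z * Real.exp w + (1 - logisticS z) * Real.exp (-w)) := by
    have : Real.exp z + Real.exp (-z) ≠ 0 := by positivity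
    rw [Real.cosh_eq, Real.cosh_eq, logisticS, neg_add, Real.exp_add, Real.exp_add]
    field_simp
    ring
  have hle : logisticS z * Real.exp w + (1 - logisticS z) * Real.exp (-w)
      ≤ Real.exp ((2 * logisticS z - 1) * w + w ^ 2) := by
    have h3 := Real.add_one_le_exp ((2 * logisticS z - 1) * w + w ^ 2)
    have h4 : logisticS z * Real.exp w ≤ logisticS z * (1 + w + w ^ 2) :=
      mul_le_mul_of_nonneg_left (by linarith) hS0
    have h5 : (1 - logisticS z) * Real.exp (-w) ≤ (1 - logisticS z) * (1 - w + w ^ 2) :=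
      mul_le_mul_of_nonneg_left (by linarith) (by linarith)
    linarith
  calc Real.log (Real.cosh (z + w))
      ≤ Real.log (Real.cosh z * Real.exp ((2 * logisticS z - 1) * w + w ^ 2)) := by
        refine Real.log_le_log (Real.cosh_pos _) ?_
        rw [heq]
        exact mul_le_mul_of_nonneg_left hle hc.le
    _ = _ := by rw [Real.log_mul hc.ne' (Real.exp_ne_zero _), Real.log_exp]

theorem abs_sub_log_two_le_log_cosh (u : ℝ) : |u| - Real.log 2 ≤ Real.log (Real.cosh u) := by
  rw [← Real.cosh_abs, Real.le_log_iff_exp_le (Real.cosh_pos _), Real.exp_sub,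
    Real.exp_log two_pos, Real.cosh_eq]
  have := Real.exp_pos (-|u|)
  linarith

/-- Exponential weights over the two actions `0` and `1` with gains `d t`: the expected gain falls at
most `√T` short of that of the better action. The potential is `log cosh`. -/
theorem hedge_lower_bound {T : ℕ} (hT : 1 ≤ T) (d : ℕ → ℝ) (hd : ∀ n, |d n| ≤ 1) :
    max (∑ t ∈ Finset.range T, d t) 0 - √T
      ≤ ∑ t ∈ Finset.range T, d t * logisticS (1 / √T * ∑ s ∈ Finset.range t, d s) := by
  have hT' : (1 : ℝ) ≤ T := by exact_mod_cast hT
  have hr : 1 ≤ √(T : ℝ) := Real.one_le_sqrt.2 hT'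
  have hrpos : 0 < √(T : ℝ) := by linarith
  set η : ℝ := 1 / √T with hη
  have hη0 : 0 < η := by positivity
  have hη1 : η ≤ 1 := (div_le_one hrpos).2 hr
  have hηT : η ^ 2 * T = 1 := by
    rw [hη, div_pow, Real.sq_sqrt (by linarith)]
    field_simp
  have hpot : ∀ n : ℕ, Real.log (Real.cosh (η * ∑ s ∈ Finset.range n, d s))
      ≤ η * (2 * ∑ t ∈ Finset.range n, d t * logisticS (η * ∑ s ∈ Finset.range t, d s)
        - ∑ t ∈ Finset.range n, d t) + η ^ 2 * n := by
    intro n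
    induction n with
    | zero => simp
    | succ n ih =>
      have hw : |η * d n| ≤ 1 := by
        rw [abs_mul, abs_of_pos hη0]
        exact mul_le_one₀ hη1 (abs_nonneg _) (hd n)
      have h1 := log_cosh_add_le (η * ∑ s ∈ Finset.range n, d s) hw
      have h2 : (η * d n) ^ 2 ≤ η ^ 2 := by
        rw [mul_pow]
        exact mul_le_of_le_one_right (by positivity) ((sq_le_one_iff_abs_le_one _).2 (hd n))
      rw [Finset.sum_range_succ, Finset.sum_range_succ, mul_add]
      push_cast
      linarith
  have h1 := hpot T
  have h2 := abs_sub_log_two_le_log_cosh (η * ∑ s ∈ Finset.range T, d s)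
  rw [abs_mul, abs_of_pos hη0] at h2
  have h3 : Real.log 2 ≤ 1 := by linarith [Real.log_two_lt_d9]
  have hη2 : η * √T = 1 := by
    rw [hη]
    field_simp
  set V := ∑ s ∈ Finset.range T, d s
  set W := ∑ t ∈ Finset.range T, d t * logisticS (η * ∑ s ∈ Finset.range t, d s)
  have h4 : η * |V| ≤ η * (2 * W - V + 2 * √T) := by nlinarith
  have h5 := le_of_mul_le_mul_left h4 hη0
  have h6 : 2 * max V 0 = V + |V| := by
    rcases le_total 0 V with h | h
    · rw [max_eq_left h, abs_of_nonneg h]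
      ring
    · rw [max_eq_right h, abs_of_nonpos h]
      ring
  linarith

theorem abs_sub_outcome_le (v : unitInterval) (i : Fin 2) : |(v : ℝ) - (i : ℕ)| ≤ 1 := by
  have h0 := v.2.1
  have h1 := v.2.2
  rw [abs_le]
  fin_cases i <;> constructor <;> norm_num <;> linarith

theorem hedgeRoundLaw_real_Iic {T : ℕ} (x : Fin T → Fin 2) {t : Fin T} (ht : (t : ℕ) ≠ 0)
    {v : unitInterval} (hv : v < 1) :
    (hedgeRoundLaw x t).real (Iic v)
      = logisticS (1 / √T * ∑ s with s < t, ((v : ℝ) - (x s : ℕ))) := by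
  have hv' : (v : ℝ) < 1 := hv
  have hcard : (Finset.univ.filter fun s : Fin T => s < t).card = (t : ℕ) := by
    rw [← Fin.card_Iio t]
    congr 1
    ext s
    simp
  rw [hedgeRoundLaw, if_neg ht, measureReal_def, forecastLaw_Iic _ _ _ hv',
    ENNReal.toReal_ofReal (logisticS_mem _).1]
  congr 1
  have : ((t : ℕ) : ℝ) ≠ 0 := by exact_mod_cast ht
  rw [Finset.sum_sub_distrib, Finset.sum_const, hcard, pastMean]
  push_cast
  field_simp
  simp

theorem sum_filter_lt_eq_sum_range {T : ℕ} (t : Fin T) (f : ℕ → ℝ) :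
    ∑ s : Fin T with s < t, f s = ∑ n ∈ Finset.range t, f n := by
  rw [Finset.sum_filter]
  simp only [Fin.lt_def]
  rw [Fin.sum_univ_eq_sum_range (fun n => if n < (t : ℕ) then f n else 0), ← Finset.sum_filter]
  congr 1
  ext n
  simp only [Finset.mem_filter, Finset.mem_range]
  have := t.2
  omega

/-- The expected cut regret of ForecastHedge, uniformly in the threshold `v`: at every threshold the
rounds after the first run exponential weights with gains `v - x_t`. -/
theorem expected_cutRegret_le {T : ℕ} (hT : 1 ≤ T) (x : Fin T → Fin 2) {v : unitInterval}
    (hv : v < 1) :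
    ∑ t, ((x t : ℕ) - (v : ℝ)) *
      ((hedgeRoundLaw x t).real (Iic v) - (if baseRate x ≤ v then 1 else 0)) ≤ 2 * √T := by
  set d : ℕ → ℝ := fun n => if h : n < T then (v : ℝ) - (x ⟨n, h⟩ : ℕ) else 0
  have hdt : ∀ t : Fin T, d t = (v : ℝ) - (x t : ℕ) := fun t => by simp [d]
  have hd : ∀ n, |d n| ≤ 1 := fun n => by
    by_cases h : n < T
    · simpa [d, h] using abs_sub_outcome_le v (x ⟨n, h⟩)
    · simp [d, h]
  have hhedge := hedge_lower_bound hT d hd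
  rw [← Fin.sum_univ_eq_sum_range, ← Fin.sum_univ_eq_sum_range
    (fun n => d n * logisticS (1 / √T * ∑ s ∈ Finset.range n, d s))] at hhedge
  have hV : ∑ t : Fin T, d t = T * ((v : ℝ) - baseRate x) := by
    simp only [hdt, Finset.sum_sub_distrib, sum_outcomes, Finset.sum_const, Finset.card_univ,
      Fintype.card_fin, nsmul_eq_mul]
    ring
  have hbase : ∑ t : Fin T, d t * (if baseRate x ≤ v then 1 else 0) ≤ max (∑ t : Fin T, d t) 0 := by
    rw [← Finset.sum_mul]
    split_ifs <;> simp
  -- Only the first round is not played by exponential weights.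
  have hround : ∀ t : Fin T, d t * (logisticS (1 / √T * ∑ s ∈ Finset.range t, d s)
      - (hedgeRoundLaw x t).real (Iic v)) ≤ if t = ⟨0, hT⟩ then 1 else 0 := fun t => by
    split_ifs with ht
    · refine (le_abs_self _).trans ?_
      rw [abs_mul]
      refine mul_le_one₀ (hd t) (abs_nonneg _) (abs_le.2 ?_)
      obtain ⟨h0, h1⟩ := logisticS_mem (1 / √T * ∑ s ∈ Finset.range t, d s)
      have h2 : 0 ≤ (hedgeRoundLaw x t).real (Iic v) := measureReal_nonneg
      have h3 : (hedgeRoundLaw x t).real (Iic v) ≤ 1 := measureReal_le_one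
      constructor <;> linarith
    · have ht' : (t : ℕ) ≠ 0 := fun h => ht (Fin.ext h)
      rw [hedgeRoundLaw_real_Iic x ht' hv, ← sum_filter_lt_eq_sum_range]
      simp only [hdt, sub_self, mul_zero, le_refl]
  have hsum := Finset.sum_le_sum fun t (_ : t ∈ Finset.univ) => hround t
  rw [Finset.sum_ite_eq' Finset.univ] at hsum
  simp only [Finset.mem_univ, if_true, mul_sub, Finset.sum_sub_distrib] at hsum
  have hr : 1 ≤ √(T : ℝ) := Real.one_le_sqrt.2 (by exact_mod_cast hT)
  have heq : ∑ t, ((x t : ℕ) - (v : ℝ)) *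
      ((hedgeRoundLaw x t).real (Iic v) - (if baseRate x ≤ v then 1 else 0))
      = ∑ t : Fin T, d t * (if baseRate x ≤ v then 1 else 0)
        - ∑ t : Fin T, d t * (hedgeRoundLaw x t).real (Iic v) := by
    rw [← Finset.sum_sub_distrib]
    refine Finset.sum_congr rfl fun t _ => ?_
    rw [hdt]
    ring
  rw [heq]
  linarith

/-! ### Expected U-calibration error -/

/-- The cut regret splits into its expectation and two weighted deviations of the empirical
distribution function, whose weights `x_t` and `1` do not depend on the threshold. -/
theorem cutRegret_eq {T : ℕ} (p : Fin T → unitInterval) (x : Fin T → Fin 2) (v : unitInterval) :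
    cutRegret v p x
      = ∑ t, ((x t : ℕ) : ℝ) * ((if p t ≤ v then 1 else 0) - (hedgeRoundLaw x t).real (Iic v))
        - v * ∑ t, 1 * ((if p t ≤ v then 1 else 0) - (hedgeRoundLaw x t).real (Iic v))
        + ∑ t, ((x t : ℕ) - (v : ℝ)) *
          ((hedgeRoundLaw x t).real (Iic v) - (if baseRate x ≤ v then 1 else 0)) := by
  have hnot : ∀ q : unitInterval, (if v < q then (1 : ℝ) else 0) = 1 - if q ≤ v then 1 else 0 :=
    fun q => by
      rcases le_or_gt q v with h | h
      · simp [h, h.not_gt]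
      · simp [h, h.not_ge]
  rw [cutRegret, Finset.mul_sum, ← Finset.sum_sub_distrib, ← Finset.sum_add_distrib]
  refine Finset.sum_congr rfl fun t _ => ?_
  rw [hnot, hnot]
  ring

theorem exists_countable_meetsIntervals :
    ∃ S : Set unitInterval, S.Countable ∧ MeetsIntervals S ∧ ∀ v ∈ S, v < 1 := by
  obtain ⟨s, hs, hd⟩ := TopologicalSpace.exists_countable_dense unitInterval
  refine ⟨s ∩ Iio 1, hs.mono inter_subset_left, fun u w huw => ?_, fun v hv => hv.2⟩
  obtain ⟨v, hv, h1, h2⟩ := hd.exists_between huw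
  exact ⟨v, ⟨hv, h2.trans_le unitInterval.le_one'⟩, h1, h2⟩

/-- The largest weighted deviation of the empirical distribution function of the predictions from
its mean under ForecastHedge, over the thresholds in `S`. -/
def deviationSup (S : Set unitInterval) {T : ℕ} (x : Fin T → Fin 2) (w : Fin T → ℝ)
    (p : Fin T → unitInterval) : ENNReal :=
  ⨆ k : S, ‖∑ t, w t *
    ((if p t ≤ k then 1 else 0) - (hedgeRoundLaw x t).real (Iic (k : unitInterval)))‖ₑ

theorem measurable_deviationSup {S : Set unitInterval} (hS : S.Countable) {T : ℕ}
    (x : Fin T → Fin 2) (w : Fin T → ℝ) : Measurable (deviationSup S x w) := by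
  have := hS.to_subtype
  refine Measurable.iSup fun k => Measurable.enorm ?_
  refine Finset.measurable_sum _ fun t _ =>
    Measurable.const_mul (Measurable.sub ?_ measurable_const) _
  exact Measurable.ite (p := fun p : Fin T → unitInterval => p t ∈ Iic (k : unitInterval))
    (measurable_pi_apply t measurableSet_Iic) measurable_const measurable_const

theorem lintegral_deviationSup_le {S : Set unitInterval} (hS : S.Countable) {T : ℕ}
    (x : Fin T → Fin 2) {w : Fin T → ℝ} (hw : ∀ t, w t ^ 2 ≤ 1) :
    ∫⁻ p, deviationSup S x w p ∂(forecastHedge x) ≤ ENNReal.ofReal (8 * √T) := by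
  have := hS.to_subtype
  refine (lintegral_iSup_empirical_le (fun _ => measurableSet_Iic) (fun k : S => (k : unitInterval))
    w (hedgeRoundLaw x)).trans (ENNReal.ofReal_le_ofReal ?_)
  refine mul_le_mul_of_nonneg_left (Real.sqrt_le_sqrt ?_) (by norm_num)
  simpa using Finset.sum_le_sum fun t (_ : t ∈ Finset.univ) => hw t

theorem ofReal_UCal_le {S : Set unitInterval} (hS : MeetsIntervals S) (hS1 : ∀ v ∈ S, v < 1)
    {T : ℕ} (hT : 1 ≤ T) (x : Fin T → Fin 2) (p : Fin T → unitInterval) :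
    ENNReal.ofReal (UCal p x) ≤ 4 * (deviationSup S x (fun t => ((x t : ℕ) : ℝ)) p
      + deviationSup S x (fun _ => 1) p + ENNReal.ofReal (2 * √T)) := by
  set Y := deviationSup S x (fun t => ((x t : ℕ) : ℝ)) p with hY
  set Y' := deviationSup S x (fun _ => 1) p with hY'
  by_cases hfin : Y + Y' = ⊤
  · simp [hfin]
  obtain ⟨hf, hf'⟩ := not_or.1 (mt ENNReal.add_eq_top.2 hfin)
  have hdev : ∀ (w : Fin T → ℝ), deviationSup S x w p ≠ ⊤ → ∀ v ∈ S,
      |∑ t, w t * ((if p t ≤ v then 1 else 0) - (hedgeRoundLaw x t).real (Iic v))|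
        ≤ (deviationSup S x w p).toReal := fun w hw v hv => by
    rw [← ENNReal.ofReal_le_iff_le_toReal hw, ← Real.enorm_eq_ofReal_abs]
    exact le_iSup (fun k : S => ‖∑ t, w t * ((if p t ≤ k then (1 : ℝ) else 0)
      - (hedgeRoundLaw x t).real (Iic (k : unitInterval)))‖ₑ) ⟨v, hv⟩
  -- A real bound on all cut regrets, as needed for the decomposition of proper rules.
  have hcut : ∀ v ∈ S, cutRegret v p x ≤ Y.toReal + Y'.toReal + 2 * √T := fun v hv => by
    have h1 := (le_abs_self _).trans (hdev _ hf v hv)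
    have h2 := hdev _ hf' v hv
    have h3 := expected_cutRegret_le hT x (hS1 v hv)
    have h4 : -(v * ∑ t, 1 * ((if p t ≤ v then 1 else 0) - (hedgeRoundLaw x t).real (Iic v)))
        ≤ Y'.toReal := by
      refine (neg_le_abs _).trans ?_
      rw [abs_mul, abs_of_nonneg v.2.1]
      exact (mul_le_of_le_one_left (abs_nonneg _) v.2.2).trans h2
    rw [cutRegret_eq]
    linarith
  have hB : 0 ≤ Y.toReal + Y'.toReal + 2 * √(T : ℝ) := by positivity
  have : Nonempty boundedProperRules := ⟨⟨vShaped 0, vShaped_mem 0⟩⟩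
  have hU : UCal p x ≤ 4 * (Y.toReal + Y'.toReal + 2 * √T) :=
    ciSup_le fun ℓ => regret_le_four_mul hS hcut hB ℓ.2
  refine (ENNReal.ofReal_le_ofReal hU).trans (le_of_eq ?_)
  rw [ENNReal.ofReal_mul (by norm_num), ENNReal.ofReal_add (by positivity) (by positivity),
    ENNReal.ofReal_add (by positivity) (by positivity), ENNReal.ofReal_toReal hf,
    ENNReal.ofReal_toReal hf']
  norm_num

theorem lintegral_ofReal_UCal_le {T : ℕ} (hT : 1 ≤ T) (x : Fin T → Fin 2) :
    ∫⁻ p, ENNReal.ofReal (UCal p x) ∂(forecastHedge x) ≤ ENNReal.ofReal (72 * √T) := by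
  obtain ⟨S, hSc, hS, hS1⟩ := exists_countable_meetsIntervals
  have : IsProbabilityMeasure (forecastHedge x) := by
    unfold forecastHedge
    infer_instance
  refine (lintegral_mono (ofReal_UCal_le hS hS1 hT x)).trans ?_
  rw [lintegral_const_mul' _ _ (by norm_num), lintegral_add_right _ measurable_const,
    lintegral_add_left (measurable_deviationSup hSc x _), lintegral_const, measure_univ, mul_one]
  have h1 := lintegral_deviationSup_le hSc x (w := fun t => ((x t : ℕ) : ℝ)) fun t => by
    generalize x t = i
    fin_cases i <;> simp
  have h2 := lintegral_deviationSup_le hSc x (w := fun _ => 1) fun t => by simp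
  refine (mul_le_mul_right (add_le_add_left (add_le_add h1 h2) _) 4).trans (le_of_eq ?_)
  rw [← ENNReal.ofReal_add (by positivity) (by positivity),
    ← ENNReal.ofReal_add (by positivity) (by positivity),
    show (4 : ENNReal) = ENNReal.ofReal 4 by norm_num, ← ENNReal.ofReal_mul (by norm_num)]
  ring_nf

end UCalibration

end

theorem mainTheorem1 :
    ∃ C : ℝ, ∀ (T : ℕ), 1 ≤ T → ∀ x : Fin T → Fin 2,
      (MeasureTheory.Integrable (fun p => UCalibration.VCal p x) (UCalibration.forecastHedge x) ∧
        ∫ p, UCalibration.VCal p x ∂(UCalibration.forecastHedge x) ≤ C * Real.sqrt T) ∧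
      (MeasureTheory.Integrable (fun p => UCalibration.UCal p x) (UCalibration.forecastHedge x) ∧
        ∫ p, UCalibration.UCal p x ∂(UCalibration.forecastHedge x) ≤ C * Real.sqrt T) := by
  refine ⟨72, fun T hT x => ?_⟩
  have hle := UCalibration.lintegral_ofReal_UCal_le hT x
  have hV0 := fun p => UCalibration.VCal_nonneg p x
  have hVU := fun p => UCalibration.VCal_le_UCal p x
  have hU0 := fun p => (hV0 p).trans (hVU p)
  have hUm := (UCalibration.lowerSemicontinuous_UCal x).measurable.aestronglyMeasurable
    (μ := UCalibration.forecastHedge x)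
  have hVm := (UCalibration.lowerSemicontinuous_VCal x).measurable.aestronglyMeasurable
    (μ := UCalibration.forecastHedge x)
  have hUi : Integrable (fun p => UCalibration.UCal p x) (UCalibration.forecastHedge x) :=
    ⟨hUm, (hasFiniteIntegral_iff_ofReal (ae_of_all _ hU0)).2 (hle.trans_lt ENNReal.ofReal_lt_top)⟩
  have hVi : Integrable (fun p => UCalibration.VCal p x) (UCalibration.forecastHedge x) :=
    hUi.mono' hVm (ae_of_all _ fun p => by
      rw [Real.norm_of_nonneg (hV0 p)]
      exact hVU p)
  have hUb : ∫ p, UCalibration.UCal p x ∂(UCalibration.forecastHedge x) ≤ 72 * Real.sqrt T := by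
    rw [integral_eq_lintegral_of_nonneg_ae (ae_of_all _ hU0) hUm]
    exact ENNReal.toReal_le_of_le_ofReal (by positivity) hle
  exact ⟨⟨hVi, (integral_mono hVi hUi hVU).trans hUb⟩, hUi, hUb⟩
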